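/- Let $\tilde G$ be a finite undirected multigraph (parallel edges and self-loops allowed) with edge set $E$ whose vertex set $\tilde V=S\sqcup T\sqcup V$ is partitioned into a set $S$ of inputs, a set $T$ of outputs (each element of $S\sqcup T$, called an open end, has degree one and lies on the edge $e(u)$) and a set $V$ of internal vertices. Let $c:E\to\{1,2,3,\dots\}$ be a capacity function. A tensor assignment $\mathcal T$ gives every $v\in V$ a tensor $\mathcal T_v\in\bigotimes_h\mathbb C^{c_{e(h)}}$, where $h$ runs over the edge ends at $v$ and $e(h)$ is the edge of the end $h$. Contracting along all edges yields a linear map $$\beta(\mathcal T):\bigotimes_{u\in S}\mathbb C^{c_{e(u)}}\to\bigotimes_{u\in T}\mathbb C^{c_{e(u)}},\qquad \langle J|\beta(\mathcal T)|I\rangle=\sum_{W}\prod_{v\in V}\langle W|_v\,|\,\mathcal T_v\rangle,$$ where $W$ runs over all assignments of an index in $\{1,\dots,c_e\}$ to every edge $e$ that agree with $I$ on the inputs and with $J$ on the outputs, and $W|_v$ is the part of $W$ read off at the edge ends at $v$. The quantum max-flow $\mathrm{QMF}(G,c)$ is the maximal rank of $\beta(\mathcal T)$ over all tensor assignments. An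 edge cut set is the set of all edges between $\bar S$ and $\bar T$ for a partition $\tilde V=\bar S\sqcup\bar T$ with $S\subset\bar S$, $T\subset\bar T$; the quantum min-cut $\mathrm{QMC}(G,c)$ is the minimum of $\prod_{e\in C}c_e$ over all edge cut sets $C$. Let $d>0$, $d\neq1$, be a real number such that $c'_e:=\log_d c_e\ge 0$ for every $e\in E$ (automatic if $d>1$). Direct every edge of the graph so that no edge arrives at an input and no edge starts at an output, and let $G'$ be the resulting directed classical network with capacities $c'$. A flow is a function $f:E\to[0,\infty)$ with $f\le c'$ for which inflow equals outflow at every $v\in V$; its value is the total flow on the edges that start in $S$; a max flow is a flow of largest value. The classical min-cut $\mathrm{MC}(G',c')$ is the minimum, over all partitions $\tilde V=\bar S\sqcup\bar T$ as above, of the sum of $c'_e$ over the edges $e$ that start in $\bar S$ and arrive in $\bar T$. Suppose that $\mathrm{MC}(G',c')=\log_d\mathrm{QMC}(G,c)$, and that $G'$ has a max flow $f$ such that for every edge $e$ the number $f_e$ is $\log_d$ of a positive integer, and such that no directed loop of $G'$ has non-zero flow on each of its edges. Then $$\mathrm{QMF}(G,c)=\mathrm{QMC}(G,c).$$ -/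

import Mathlib

/-- A finite undirected multigraph with open ends (parallel edges and self-loops are allowed).
`S` is the set of inputs, `T` the set of outputs, `V` the set of (internal) vertices, `E` the set
of edges.  Every edge `e` has two ends `(e, false)` and `(e, true)`; the two labels only tell the
ends apart and do not direct the edge.  `att` says where an end is attached.  Every input and every
output is attached to exactly one end of an edge (it has degree one). -/
structure OpenGraph (S T V E : Type*) where
  att : E × Bool → S ⊕ T ⊕ V
  inEnd : S → E × Bool
  outEnd : T → E × Bool
  att_eq_in : ∀ (h : E × Bool) (s : S), att h = Sum.inl s ↔ h = inEnd s
  att_eq_out : ∀ (h : E × Bool) (t : T), att h = Sum.inr (Sum.inl t) ↔ h = outEnd t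

namespace OpenGraph

variable {S T V E : Type*} (G : OpenGraph S T V E)

/-- The edge carrying the input `s`. -/
def inEdge (s : S) : E := (G.inEnd s).1

/-- The edge carrying the output `t`. -/
def outEdge (t : T) : E := (G.outEnd t).1

/-- The edge ends incident to the vertex `v` (a self-loop at `v` contributes both its ends). -/
def EndsAt (v : V) : Type _ := {h : E × Bool // G.att h = Sum.inr (Sum.inr v)}

/-! ### The tensor network and the quantum max-flow -/

/-- Tensor assignments.  The tensor at `v` lies in the tensor product of the spaces `ℂ ^ (c e)`, one
factor for each edge end at `v`, and is given by its coordinates in the standard basis. -/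
def TensorAssignment (c : E → ℕ) : Type _ :=
  (v : V) → ((h : G.EndsAt v) → Fin (c h.1.1)) → ℂ

/-- The matrix, in the standard bases of `V_S = ⨂ s, ℂ ^ (c (inEdge s))` and
`V_T = ⨂ t, ℂ ^ (c (outEdge t))`, of the linear map `V_S → V_T` given by the network: the entry at
`(J, I)` is the sum, over all index assignments `W` to the edges that extend `I` and `J`, of the
product of the tensor entries read off at the vertices. -/
noncomputable def beta [Fintype S] [Fintype T] [Fintype V] [Fintype E] [DecidableEq E]
    (c : E → ℕ) (τ : G.TensorAssignment c) :
    Matrix ((t : T) → Fin (c (G.outEdge t))) ((s : S) → Fin (c (G.inEdge s))) ℂ :=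
  fun J I =>
    ∑ W : ((e : E) → Fin (c e)),
      if (∀ s, W (G.inEdge s) = I s) ∧ (∀ t, W (G.outEdge t) = J t) then
        ∏ v : V, τ v (fun h => W h.1.1)
      else 0

/-- The quantum max-flow: the maximal rank of the linear map over all tensor assignments. -/
noncomputable def QMF [Fintype S] [Fintype T] [Fintype V] [Fintype E] [DecidableEq S]
    [DecidableEq E] (c : E → ℕ) : ℕ :=
  sSup {r | ∃ τ : G.TensorAssignment c, r = (G.beta c τ).rank}

/-- The supremum in `QMF` is a maximum. -/
theorem isGreatest_QMF [Fintype S] [Fintype T] [Fintype V] [Fintype E] [DecidableEq S]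
    [DecidableEq E] (c : E → ℕ) :
    IsGreatest {r | ∃ τ : G.TensorAssignment c, r = (G.beta c τ).rank} (G.QMF c) := by
  have hb : BddAbove {r | ∃ τ : G.TensorAssignment c, r = (G.beta c τ).rank} := by
    refine ⟨Fintype.card ((s : S) → Fin (c (G.inEdge s))), ?_⟩
    rintro r ⟨τ, rfl⟩
    exact Matrix.rank_le_card_width _
  exact ⟨Nat.sSup_mem ⟨_, (fun _ _ => 0), rfl⟩ hb, fun r hr => le_csSup hb hr⟩

/-! ### The quantum min-cut -/

/-- A set `A` of vertices and open ends (standing for the partition into `A` and its complement)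
that contains all inputs and no output. -/
def Separates (_G : OpenGraph S T V E) (A : Set (S ⊕ T ⊕ V)) : Prop :=
  (∀ s : S, Sum.inl s ∈ A) ∧ (∀ t : T, Sum.inr (Sum.inl t) ∉ A)

/-- An edge cut set of the undirected graph: all edges with one end in `A` and the other one in the
complement of `A`, for some separating `A`. -/
def IsEdgeCut (C : Finset E) : Prop :=
  ∃ A : Set (S ⊕ T ⊕ V), G.Separates A ∧
    ∀ e, e ∈ C ↔ ∃ b : Bool, G.att (e, b) ∈ A ∧ G.att (e, !b) ∉ A

/-- The quantum min-cut: the minimum, over all edge cut sets, of the product of the capacities. -/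
noncomputable def QMC (c : E → ℕ) : ℕ :=
  sInf {m | ∃ C : Finset E, G.IsEdgeCut C ∧ m = ∏ e ∈ C, c e}

theorem separates_inputs : G.Separates (Set.range Sum.inl) := by
  constructor <;> simp

/-- The infimum in `QMC` is a minimum. -/
theorem isLeast_QMC [Fintype E] (c : E → ℕ) :
    IsLeast {m | ∃ C : Finset E, G.IsEdgeCut C ∧ m = ∏ e ∈ C, c e} (G.QMC c) := by
  classical
  refine ⟨Nat.sInf_mem ⟨_, Finset.univ.filter (fun e => ∃ b : Bool,
    G.att (e, b) ∈ Set.range Sum.inl ∧ G.att (e, !b) ∉ Set.range Sum.inl),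
    ⟨Set.range Sum.inl, G.separates_inputs, ?_⟩, rfl⟩, fun r hr => Nat.sInf_le hr⟩
  intro e
  rw [Finset.mem_filter]
  exact and_iff_right (Finset.mem_univ e)

/-! ### Directing the graph; classical flows and cuts -/

/-- A direction of the edges: `dir e` is the label of the end at which `e` starts. -/
def Direction (_G : OpenGraph S T V E) : Type _ := E → Bool

variable {G}

namespace Direction

variable (dir : G.Direction)

/-- Where the edge `e` starts. -/
def tail (e : E) : S ⊕ T ⊕ V := G.att (e, dir e)

/-- Where the edge `e` arrives. -/
def head (e : E) : S ⊕ T ⊕ V := G.att (e, !dir e)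

/-- The directed network has the given inputs as sources and the given outputs as sinks: no edge
arrives at an input, and no edge starts at an output. -/
def Compatible : Prop :=
  (∀ (e : E) (s : S), dir.head e ≠ Sum.inl s) ∧
    (∀ (e : E) (t : T), dir.tail e ≠ Sum.inr (Sum.inl t))

/-- An edge cut set of the directed network: all edges that start in `A` and arrive in the
complement of `A`, for some separating `A`. -/
def IsEdgeCut (C : Finset E) : Prop :=
  ∃ A : Set (S ⊕ T ⊕ V), G.Separates A ∧ ∀ e, e ∈ C ↔ dir.tail e ∈ A ∧ dir.head e ∉ A

/-- The classical min-cut of the directed network with real capacities `k`. -/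
noncomputable def MC (k : E → ℝ) : ℝ :=
  sInf {m | ∃ C : Finset E, dir.IsEdgeCut C ∧ m = ∑ e ∈ C, k e}

/-- The infimum in `MC` is a minimum. -/
theorem isLeast_MC [Fintype E] (k : E → ℝ) :
    IsLeast {m | ∃ C : Finset E, dir.IsEdgeCut C ∧ m = ∑ e ∈ C, k e} (dir.MC k) := by
  classical
  have hfin : {m | ∃ C : Finset E, dir.IsEdgeCut C ∧ m = ∑ e ∈ C, k e}.Finite := by
    refine (Set.finite_range (fun C : Finset E => ∑ e ∈ C, k e)).subset ?_
    rintro m ⟨C, -, rfl⟩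
    exact ⟨C, rfl⟩
  refine ⟨Set.Nonempty.csInf_mem ⟨_, Finset.univ.filter (fun e =>
    dir.tail e ∈ Set.range Sum.inl ∧ dir.head e ∉ Set.range Sum.inl),
    ⟨Set.range Sum.inl, G.separates_inputs, ?_⟩, rfl⟩ hfin,
    fun r hr => csInf_le hfin.bddBelow hr⟩
  intro e
  rw [Finset.mem_filter]
  exact and_iff_right (Finset.mem_univ e)

/-- Flows with values in the nonnegative reals: capacity constraint, and conservation at every
vertex that is neither a source nor a sink. -/
structure IsFlow [Fintype E] [DecidableEq S] [DecidableEq T] [DecidableEq V]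
    (k f : E → ℝ) : Prop where
  nonneg : ∀ e, 0 ≤ f e
  le_capacity : ∀ e, f e ≤ k e
  conservation : ∀ v : V,
    ∑ e with dir.head e = Sum.inr (Sum.inr v), f e =
      ∑ e with dir.tail e = Sum.inr (Sum.inr v), f e

/-- The value of a flow: the total flow on the edges that start at a source. -/
noncomputable def value [Fintype S] [Fintype E] [DecidableEq S] [DecidableEq T] [DecidableEq V]
    (f : E → ℝ) : ℝ :=
  ∑ e with ∃ s : S, dir.tail e = Sum.inl s, f e

/-- A flow whose value is the largest among all flows. -/
def IsMaxFlow [Fintype S] [Fintype E] [DecidableEq S] [DecidableEq T] [DecidableEq V]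
    (k f : E → ℝ) : Prop :=
  dir.IsFlow k f ∧ ∀ g : E → ℝ, dir.IsFlow k g → dir.value g ≤ dir.value f

/-- There is a directed loop (a closed directed walk with at least one edge) all of whose edges
carry non-zero flow. -/
def HasFlowLoop (f : E → ℝ) : Prop :=
  ∃ x : S ⊕ T ⊕ V,
    Relation.TransGen (fun y z => ∃ e : E, dir.tail e = y ∧ dir.head e = z ∧ f e ≠ 0) x x

end Direction

end OpenGraph

/-!
For any cut, the contraction factors through the indices on the cut edges, so the rank is at most
the product of their capacities.  Conversely, write a max flow as `f e = logb d (n e)`.  By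
conservation, as many tuples of labels below `n` enter each vertex as leave it, so a bijection
`φ v` between them can be chosen; take as tensor at `v` the indicator of the tuples that match
under `φ v`.  Since no directed loop carries flow, there is a unique routed labelling for each
choice of labels at the inputs, and distinct routed labellings differ at the outputs.  The
contraction therefore contains an identity matrix of size `∏ s, n (inEdge s)`, whose logarithm is
the value of `f`.  By max-flow min-cut for the directed network this value is `MC = logb d QMC`.
-/

theorem le_of_logb_le_logb {d x y : ℝ} (hd0 : 0 < d) (hd1 : d ≠ 1) (hx : 0 < x) (hy : 1 ≤ y)
    (hx' : 0 ≤ Real.logb d x) (h : Real.logb d x ≤ Real.logb d y) : x ≤ y := by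
  rcases hd1.lt_or_gt with hd | hd
  · -- here `0 ≤ logb d x` already forces `x ≤ 1`
    exact ((Real.logb_nonneg_iff_of_base_lt_one hd0 hd hx).1 hx').trans hy
  · exact (Real.logb_le_logb hd hx (one_pos.trans_le hy)).1 h

theorem logb_injOn_pos_of_ne_one {d : ℝ} (hd0 : 0 < d) (hd1 : d ≠ 1) :
    Set.InjOn (Real.logb d) (Set.Ioi 0) :=
  hd1.lt_or_gt.elim (Real.logb_injOn_pos_of_base_lt_one hd0) Real.logb_injOn_pos

theorem logb_natCast_prod {ι : Type*} (s : Finset ι) {n : ι → ℕ} (hn : ∀ i, 1 ≤ n i) (d : ℝ) :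
    Real.logb d (∏ i ∈ s, n i : ℕ) = ∑ i ∈ s, Real.logb d (n i) := by
  rw [Nat.cast_prod, Real.logb_prod]
  exact fun i _ => Nat.cast_ne_zero.2 (Nat.one_le_iff_ne_zero.1 (hn i))

theorem wellFounded_of_forall_not_transGen {ι : Type*} [Finite ι] {r : ι → ι → Prop}
    (h : ∀ i, ¬ Relation.TransGen r i i) : WellFounded r :=
  have : Std.Irrefl (Relation.TransGen r) := ⟨h⟩
  Subrelation.wf Relation.TransGen.single (Finite.wellFounded_of_trans_of_irrefl _)

theorem exists_apply_eq_self_of_dependsOn {ι : Type*} {α : ι → Type*} [∀ i, Nonempty (α i)]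
    {r : ι → ι → Prop} (hr : WellFounded r) (F : (∀ i, α i) → ∀ i, α i)
    (hF : ∀ i, DependsOn (fun w => F w i) {j | r j i}) : ∃ w, F w = w := by
  classical
  let step (i : ι) (rec : ∀ j, r j i → α j) : α i :=
    F (fun j => if h : r j i then rec j h else Classical.arbitrary _) i
  refine ⟨hr.fix step, funext fun i => ?_⟩
  rw [hr.fix_eq]
  exact hF i fun j hj => by simp [show r j i from hj]

theorem exists_extend_of_injective {ι κ : Type*} {α : κ → Type*} [∀ k, Nonempty (α k)]
    {g : ι → κ} (hg : Function.Injective g) (x : ∀ i, α (g i)) :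
    ∃ w : ∀ k, α k, ∀ i, w (g i) = x i := by
  have (k : κ) : ∃ a : α k, ∀ i (h : g i = k), a = h ▸ x i := by
    by_cases hk : ∃ i, g i = k
    · obtain ⟨i, rfl⟩ := hk
      exact ⟨x i, fun j hj => by obtain rfl := hg hj; rfl⟩
    · exact ⟨Classical.arbitrary _, fun i hi => absurd ⟨i, hi⟩ hk⟩
  choose w hw using this
  exact ⟨w, fun i => hw _ i rfl⟩

theorem eventually_nonneg_add_mul {x y : ℝ} (hx : 0 ≤ x) (hxy : y < 0 → 0 < x) :
    ∀ᶠ r in nhdsWithin (0 : ℝ) (Set.Ioi 0), 0 ≤ x + r * y := by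
  rcases le_or_gt 0 y with hy | hy
  · filter_upwards [self_mem_nhdsWithin] with r hr
    exact add_nonneg hx (mul_nonneg (Set.mem_Ioi.1 hr).le hy)
  · have hcont : Filter.Tendsto (fun r : ℝ => x + r * y) (nhds 0) (nhds (x + 0 * y)) :=
      Continuous.tendsto (by fun_prop) 0
    rw [zero_mul, add_zero] at hcont
    filter_upwards [(hcont.mono_left nhdsWithin_le_nhds).eventually (lt_mem_nhds (hxy hy))]
      with r hr using hr.le

section RankFactorization

variable {ι R : Type*} [Fintype ι] [DecidableEq ι] {α : ι → Type*} [∀ i, Fintype (α i)]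

theorem sum_mul_eq_of_dependsOn [CommSemiring R] (p : ι → Prop) [DecidablePred p] (w₀ : ∀ i, α i)
    {F G : (∀ i, α i) → R} (hF : DependsOn F {i | p i}) (hG : DependsOn G {i | ¬ p i}) :
    ∑ w, F w * G w =
      (∑ u : (i : {i // p i}) → α i, F fun i => if h : p i then u ⟨i, h⟩ else w₀ i) *
        ∑ u : (i : {i // ¬ p i}) → α i, G fun i => if h : p i then w₀ i else u ⟨i, h⟩ := by
  rw [← (Equiv.piEquivPiSubtypeProd p α).symm.sum_comp, Fintype.sum_prod_type, Finset.sum_mul_sum]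
  refine Finset.sum_congr rfl fun u _ => Finset.sum_congr rfl fun v _ => congrArg₂ _ ?_ ?_
  · exact hF fun i hi => by simp_all [Equiv.piEquivPiSubtypeProd]
  · exact hG fun i hi => by simp_all [Equiv.piEquivPiSubtypeProd]

theorem exists_eq_mul_of_dependsOn [CommSemiring R] {m n : Type*} [Nonempty (∀ i, α i)]
    {Y : m → (∀ i, α i) → R} {X : n → (∀ i, α i) → R} {a b : Set ι} {C : Finset ι}
    (hY : ∀ j, DependsOn (Y j) a) (hX : ∀ k, DependsOn (X k) b) (hC : a ∩ b ⊆ C) :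
    ∃ (P : Matrix m (∀ i : C, α i) R) (Q : Matrix (∀ i : C, α i) n R),
      Matrix.of (fun j k => ∑ w, Y j w * X k w) = P * Q := by
  classical
  let w₀ (i : {i // i ∉ C}) : α i := Classical.arbitrary (∀ i, α i) i
  let glue := (Equiv.piEquivPiSubtypeProd (· ∈ C) α).symm
  let p (i : {i // i ∉ C}) : Prop := (i : ι) ∈ a
  refine ⟨.of fun j u => ∑ v : (i : {i // p i}) → α i.1,
      Y j (glue (u, fun i => if h : p i then v ⟨i, h⟩ else w₀ i)),
    .of fun u k => ∑ v : (i : {i // ¬ p i}) → α i.1,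
      X k (glue (u, fun i => if h : p i then w₀ i else v ⟨i, h⟩)), ?_⟩
  ext j k
  rw [Matrix.mul_apply, Matrix.of_apply, ← glue.sum_comp, Fintype.sum_prod_type]
  refine Finset.sum_congr rfl fun u _ =>
    sum_mul_eq_of_dependsOn (F := fun v => Y j (glue (u, v))) (G := fun v => X k (glue (u, v)))
      p w₀ (fun v v' h => hY j fun i hi => ?_) (fun v v' h => hX k fun i hi => ?_)
  · by_cases hiC : i ∈ C
    · simp [glue, hiC]
    · simpa [glue, hiC] using h ⟨i, hiC⟩ hi
  · by_cases hiC : i ∈ C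
    · simp [glue, hiC]
    · simpa [glue, hiC] using h ⟨i, hiC⟩ fun ha => hiC (hC ⟨ha, hi⟩)

theorem rank_of_sum_mul_le_prod_card [CommSemiring R] [StrongRankCondition R]
    {m n : Type*} [Fintype n] {Y : m → (∀ i, α i) → R} {X : n → (∀ i, α i) → R} {a b : Set ι}
    {C : Finset ι} (hY : ∀ j, DependsOn (Y j) a) (hX : ∀ k, DependsOn (X k) b)
    (hC : a ∩ b ⊆ C) :
    (Matrix.of fun j k => ∑ w, Y j w * X k w).rank ≤ ∏ i ∈ C, Fintype.card (α i) := by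
  cases isEmpty_or_nonempty (∀ i, α i)
  · have := nontrivial_of_invariantBasisNumber R
    have hzero : (Matrix.of fun j k => ∑ w, Y j w * X k w) = 0 := by ext; simp
    rw [hzero, Matrix.rank_zero]
    exact Nat.zero_le _
  · obtain ⟨P, Q, h⟩ := exists_eq_mul_of_dependsOn hY hX hC
    calc (Matrix.of fun j k => ∑ w, Y j w * X k w).rank
        ≤ P.rank := by rw [h]; exact Matrix.rank_mul_le_left P Q
      _ ≤ Fintype.card (∀ i : C, α i) := P.rank_le_card_width
      _ = ∏ i ∈ C, Fintype.card (α i) := by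
        rw [Fintype.card_pi, Finset.prod_coe_sort C fun i => Fintype.card (α i)]

end RankFactorization

namespace OpenGraph

variable {S T V E : Type*} {G : OpenGraph S T V E}

section QuantumMinCut

theorem att_inEnd (s : S) : G.att (G.inEnd s) = Sum.inl s := (G.att_eq_in _ _).2 rfl

theorem att_outEnd (t : T) : G.att (G.outEnd t) = Sum.inr (Sum.inl t) := (G.att_eq_out _ _).2 rfl

variable (G) in
/-- The edges with at least one end in `A`. -/
def incidentEdges (A : Set (S ⊕ T ⊕ V)) : Set E := {e | ∃ b, G.att (e, b) ∈ A}

theorem Separates.inEdge_mem_incidentEdges {A : Set (S ⊕ T ⊕ V)} (hA : G.Separates A) (s : S) :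
    G.inEdge s ∈ G.incidentEdges A :=
  ⟨(G.inEnd s).2, by simpa only [inEdge, Prod.mk.eta, att_inEnd] using hA.1 s⟩

theorem Separates.outEdge_mem_incidentEdges_compl {A : Set (S ⊕ T ⊕ V)} (hA : G.Separates A)
    (t : T) : G.outEdge t ∈ G.incidentEdges Aᶜ :=
  ⟨(G.outEnd t).2, by
    simpa only [outEdge, Prod.mk.eta, att_outEnd, Set.mem_compl_iff] using hA.2 t⟩

theorem mem_incidentEdges_inter_compl {A : Set (S ⊕ T ⊕ V)} {e : E} :
    e ∈ G.incidentEdges A ∩ G.incidentEdges Aᶜ ↔ ∃ b, G.att (e, b) ∈ A ∧ G.att (e, !b) ∉ A := by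
  simp only [incidentEdges, Set.mem_inter_iff, Set.mem_ofPred_eq, Set.mem_compl_iff,
    Bool.exists_bool, Bool.not_false, Bool.not_true]
  tauto

theorem logb_QMC_nonneg [Finite E] {c : E → ℕ} (hc : ∀ e, 1 ≤ c e) {d : ℝ}
    (hlog : ∀ e, 0 ≤ Real.logb d (c e)) : 0 ≤ Real.logb d (G.QMC c) := by
  have := Fintype.ofFinite E
  obtain ⟨C, -, hC⟩ := (G.isLeast_QMC c).1
  rw [hC, logb_natCast_prod C hc]
  exact Finset.sum_nonneg fun e _ => hlog e

theorem QMC_pos [Finite E] {c : E → ℕ} (hc : ∀ e, 1 ≤ c e) : 0 < G.QMC c := by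
  have := Fintype.ofFinite E
  obtain ⟨C, -, hC⟩ := (G.isLeast_QMC c).1
  exact hC ▸ Finset.prod_pos fun e _ => hc e

variable [Fintype V] {c : E → ℕ}

open Classical in
/-- The product of the tensor entries read off at the internal vertices in `A`: the part of a
summand of the contraction that belongs to `A`. -/
noncomputable def vertexWeight (τ : G.TensorAssignment c) (A : Set (S ⊕ T ⊕ V))
    (W : (e : E) → Fin (c e)) : ℂ :=
  ∏ v : V with Sum.inr (Sum.inr v) ∈ A, τ v fun h => W h.1.1

theorem vertexWeight_mul_compl (τ : G.TensorAssignment c) (A : Set (S ⊕ T ⊕ V))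
    (W : (e : E) → Fin (c e)) :
    vertexWeight τ A W * vertexWeight τ Aᶜ W = ∏ v, τ v fun h => W h.1.1 := by
  classical
  rw [← Finset.prod_filter_mul_prod_filter_not Finset.univ
    (fun v : V => (Sum.inr (Sum.inr v) : S ⊕ T ⊕ V) ∈ A)]
  unfold vertexWeight
  congr

theorem dependsOn_vertexWeight (τ : G.TensorAssignment c) (A : Set (S ⊕ T ⊕ V)) :
    DependsOn (vertexWeight τ A) (G.incidentEdges A) := by
  classical
  intro W W' h
  refine Finset.prod_congr rfl fun v hv => congrArg (τ v) <| funext fun x => h _ ⟨x.1.2, ?_⟩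
  simpa only [Prod.mk.eta, x.2] using (Finset.mem_filter_univ v).1 hv

variable [Fintype S] [Fintype T] [Fintype E] [DecidableEq E]

theorem beta_eq_sum_mul (τ : G.TensorAssignment c) (A : Set (S ⊕ T ⊕ V)) :
    G.beta c τ = Matrix.of fun J I => ∑ W,
      (if ∀ t, W (G.outEdge t) = J t then vertexWeight τ Aᶜ W else 0) *
        (if ∀ s, W (G.inEdge s) = I s then vertexWeight τ A W else 0) := by
  ext J I
  refine Finset.sum_congr rfl fun W _ => ?_
  rw [ite_zero_mul_ite_zero, mul_comm, vertexWeight_mul_compl]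
  exact if_congr and_comm rfl rfl

theorem rank_beta_le_prod [DecidableEq S] (τ : G.TensorAssignment c) {C : Finset E}
    (hC : G.IsEdgeCut C) : (G.beta c τ).rank ≤ ∏ e ∈ C, c e := by
  obtain ⟨A, hA, hCA⟩ := hC
  rw [beta_eq_sum_mul τ A]
  refine (rank_of_sum_mul_le_prod_card (a := G.incidentEdges Aᶜ) (b := G.incidentEdges A) (C := C)
    (fun J W W' h => ?_) (fun I W W' h => ?_)
    fun e he => (hCA e).2 (mem_incidentEdges_inter_compl.1 he.symm)).trans_eq
      (by simp only [Fintype.card_fin])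
  · simp only [dependsOn_vertexWeight τ Aᶜ h, h _ (hA.outEdge_mem_incidentEdges_compl _)]
  · simp only [dependsOn_vertexWeight τ A h, h _ (hA.inEdge_mem_incidentEdges _)]

theorem QMF_le_QMC [DecidableEq S] (G : OpenGraph S T V E) (c : E → ℕ) : G.QMF c ≤ G.QMC c := by
  obtain ⟨τ, hτ⟩ := (G.isGreatest_QMF c).1
  obtain ⟨C, hC, hm⟩ := (G.isLeast_QMC c).1
  rw [hτ, hm]
  exact rank_beta_le_prod τ hC

end QuantumMinCut

namespace Direction

variable {dir : G.Direction}

theorem Compatible.tail_inEdge (hdir : dir.Compatible) (s : S) :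
    dir.tail (G.inEdge s) = Sum.inl s := by
  have hs : G.att (G.inEdge s, (G.inEnd s).2) = Sum.inl s := att_inEnd s
  have hhead : (G.inEnd s).2 ≠ !dir (G.inEdge s) := fun h => hdir.1 _ s (h ▸ hs)
  rwa [Bool.eq_not_of_ne hhead, Bool.not_not] at hs

theorem Compatible.tail_eq_inl_iff (hdir : dir.Compatible) {e : E} {s : S} :
    dir.tail e = Sum.inl s ↔ e = G.inEdge s :=
  ⟨fun h => congrArg Prod.fst ((G.att_eq_in _ _).1 h), fun h => h ▸ hdir.tail_inEdge s⟩

theorem eq_outEdge_of_head_eq {e : E} {t : T} (h : dir.head e = Sum.inr (Sum.inl t)) :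
    e = G.outEdge t :=
  congrArg Prod.fst ((G.att_eq_out _ _).1 h)

theorem Compatible.inEdge_injective (hdir : dir.Compatible) : Function.Injective G.inEdge :=
  fun s s' h => Sum.inl_injective <| by rw [← hdir.tail_inEdge, h, hdir.tail_inEdge]

section MaxFlowMinCut

/-- The directions `g` in which the flow `f` can be moved a little without becoming negative or
exceeding the capacities `k`. -/
structure IsFeasibleDirection (k f g : E → ℝ) : Prop where
  pos_of_neg : ∀ e, g e < 0 → 0 < f e
  lt_of_pos : ∀ e, 0 < g e → f e < k e

namespace IsFeasibleDirection

variable {k f g h : E → ℝ}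

theorem zero : IsFeasibleDirection k f 0 :=
  ⟨fun _ he => absurd he (lt_irrefl 0), fun _ he => absurd he (lt_irrefl 0)⟩

theorem add (hg : IsFeasibleDirection k f g) (hh : IsFeasibleDirection k f h) :
    IsFeasibleDirection k f (g + h) where
  pos_of_neg e he := by
    rcases lt_or_ge (g e) 0 with hge | hge
    · exact hg.pos_of_neg e hge
    · exact hh.pos_of_neg e ((le_add_of_nonneg_left hge).trans_lt he)
  lt_of_pos e he := by
    rcases lt_or_ge 0 (g e) with hge | hge
    · exact hg.lt_of_pos e hge
    · exact hh.lt_of_pos e (he.trans_le (add_le_of_nonpos_left hge))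

theorem single [DecidableEq E] {e : E} {r : ℝ} (hneg : r < 0 → 0 < f e)
    (hpos : 0 < r → f e < k e) : IsFeasibleDirection k f (Pi.single e r) where
  pos_of_neg e' he' := by
    obtain rfl : e' = e := by_contra fun h => by simp [h] at he'
    exact hneg (by simpa using he')
  lt_of_pos e' he' := by
    obtain rfl : e' = e := by_contra fun h => by simp [h] at he'
    exact hpos (by simpa using he')

theorem exists_pos_add_smul_mem_Icc [Finite E] (hg : IsFeasibleDirection k f g)
    (hf : f ∈ Set.Icc 0 k) : ∃ r : ℝ, 0 < r ∧ f + r • g ∈ Set.Icc 0 k := by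
  have hlower : ∀ᶠ r in nhdsWithin (0 : ℝ) (Set.Ioi 0), ∀ e, 0 ≤ f e + r * g e :=
    Filter.eventually_all.2 fun e => eventually_nonneg_add_mul (hf.1 e) (hg.pos_of_neg e)
  have hupper : ∀ᶠ r in nhdsWithin (0 : ℝ) (Set.Ioi 0), ∀ e, 0 ≤ (k e - f e) + r * -g e :=
    Filter.eventually_all.2 fun e => eventually_nonneg_add_mul (sub_nonneg.2 (hf.2 e))
      fun he => sub_pos.2 (hg.lt_of_pos e (neg_lt_zero.1 he))
  obtain ⟨r, ⟨hl, hu⟩, hr⟩ := ((hlower.and hupper).and self_mem_nhdsWithin).exists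
  refine ⟨r, hr, hl, fun e => ?_⟩
  simp only [Pi.add_apply, Pi.smul_apply, smul_eq_mul]
  linarith [hu e]

end IsFeasibleDirection

variable (dir) in
/-- One step in the residual network of `f`: along an unsaturated edge, or backwards along an edge
with positive flow. -/
def Residual (k f : E → ℝ) (x y : S ⊕ T ⊕ V) : Prop :=
  ∃ e, (dir.tail e = x ∧ dir.head e = y ∧ f e < k e) ∨
    (dir.head e = x ∧ dir.tail e = y ∧ 0 < f e)

variable [Fintype E] [DecidableEq S] [DecidableEq T] [DecidableEq V]

variable (dir) in
/-- Inflow minus outflow at every vertex and open end, as a linear function of the flow. -/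
noncomputable def netInflow : (E → ℝ) →ₗ[ℝ] (S ⊕ T ⊕ V → ℝ) :=
  Fintype.linearCombination ℝ fun e => Pi.single (dir.head e) 1 - Pi.single (dir.tail e) 1

theorem netInflow_single [DecidableEq E] (e : E) (r : ℝ) :
    dir.netInflow (Pi.single e r) = r • (Pi.single (dir.head e) 1 - Pi.single (dir.tail e) 1) :=
  Fintype.linearCombination_apply_single ℝ _ e r

theorem netInflow_apply (f : E → ℝ) (x : S ⊕ T ⊕ V) :
    dir.netInflow f x = ∑ e with dir.head e = x, f e - ∑ e with dir.tail e = x, f e := by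
  simp [netInflow, Fintype.linearCombination_apply, Pi.single_apply, mul_sub,
    Finset.sum_filter, eq_comm]

theorem netInflow_vertex_eq_zero_iff {f : E → ℝ} {v : V} :
    dir.netInflow f (Sum.inr (Sum.inr v)) = 0 ↔
      ∑ e with dir.head e = Sum.inr (Sum.inr v), f e =
        ∑ e with dir.tail e = Sum.inr (Sum.inr v), f e := by
  rw [netInflow_apply, sub_eq_zero]

theorem sum_netInflow (f : E → ℝ) (A : Finset (S ⊕ T ⊕ V)) :
    ∑ x ∈ A, dir.netInflow f x =
      ∑ e with dir.head e ∈ A, f e - ∑ e with dir.tail e ∈ A, f e := by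
  simp only [netInflow_apply, Finset.sum_sub_distrib, Finset.sum_filter]
  rw [Finset.sum_comm, Finset.sum_comm (s := A)]
  simp only [Finset.sum_ite_eq]

theorem exists_isFeasibleDirection_of_reflTransGen {k f : E → ℝ} {x y : S ⊕ T ⊕ V}
    (h : Relation.ReflTransGen (dir.Residual k f) x y) :
    ∃ g, IsFeasibleDirection k f g ∧ dir.netInflow g = Pi.single y 1 - Pi.single x 1 := by
  classical
  induction h with
  | refl => exact ⟨0, .zero, by simp⟩
  | tail _ hyz ih =>
    obtain ⟨g, hg, hflow⟩ := ih
    obtain ⟨e, ⟨rfl, rfl, he⟩ | ⟨rfl, rfl, he⟩⟩ := hyz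
    · refine ⟨g + Pi.single e 1, hg.add (.single (fun h => by linarith) fun _ => he), ?_⟩
      rw [map_add, hflow, netInflow_single]
      module
    · refine ⟨g + Pi.single e (-1), hg.add (.single (fun _ => he) fun h => by linarith), ?_⟩
      rw [map_add, hflow, netInflow_single]
      module

variable [Fintype S]

theorem Compatible.value_eq_sum_inEdge (hdir : dir.Compatible) (f : E → ℝ) :
    dir.value f = ∑ s, f (G.inEdge s) := by
  classical
  have hsources : ({e | ∃ s, dir.tail e = Sum.inl s} : Finset E) = Finset.univ.image G.inEdge := by
    ext e
    simp [hdir.tail_eq_inl_iff, eq_comm]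
  rw [value, hsources, Finset.sum_image hdir.inEdge_injective.injOn]

theorem Compatible.value_eq_neg_sum_netInflow (hdir : dir.Compatible) (f : E → ℝ) :
    dir.value f = -∑ s : S, dir.netInflow f (Sum.inl s) := by
  classical
  rw [hdir.value_eq_sum_inEdge, ← Finset.sum_neg_distrib]
  refine Finset.sum_congr rfl fun s _ => ?_
  simp [netInflow_apply, hdir.1, hdir.tail_eq_inl_iff, Finset.sum_filter]

theorem IsMaxFlow.not_reflTransGen_residual {k f : E → ℝ} (hf : dir.IsMaxFlow k f)
    (hdir : dir.Compatible) (s : S) (t : T) :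
    ¬ Relation.ReflTransGen (dir.Residual k f) (Sum.inl s) (Sum.inr (Sum.inl t)) := by
  intro h
  obtain ⟨g, hg, hflow⟩ := exists_isFeasibleDirection_of_reflTransGen h
  obtain ⟨r, hr, hl, hu⟩ := hg.exists_pos_add_smul_mem_Icc ⟨hf.1.nonneg, hf.1.le_capacity⟩
  have hfg : dir.IsFlow k (f + r • g) := ⟨hl, hu, fun v => by
    rw [← netInflow_vertex_eq_zero_iff, map_add, map_smul, hflow, Pi.add_apply,
      netInflow_vertex_eq_zero_iff.2 (hf.1.conservation v)]
    simp⟩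
  have hunit : dir.value g = 1 := by
    simp [hdir.value_eq_neg_sum_netInflow, hflow, Pi.single_apply]
  have hvalue : dir.value (f + r • g) = dir.value f + r := by
    simp only [value, Pi.add_apply, Pi.smul_apply, Finset.sum_add_distrib, ← Finset.smul_sum]
    rw [← value, ← value, hunit, smul_eq_mul, mul_one]
  linarith [hf.2 _ hfg]

theorem IsFlow.value_eq_sub {k f : E → ℝ} (hf : dir.IsFlow k f) (hdir : dir.Compatible)
    {A : Finset (S ⊕ T ⊕ V)} (hA : G.Separates A) :
    dir.value f = ∑ e with dir.tail e ∈ A, f e - ∑ e with dir.head e ∈ A, f e := by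
  have hsum : ∑ x ∈ A, dir.netInflow f x = ∑ s : S, dir.netInflow f (Sum.inl s) := by
    have hin (s : S) : Sum.inl s ∈ A := hA.1 s
    have hout (t : T) : Sum.inr (Sum.inl t) ∉ A := hA.2 t
    have hv (v : V) : dir.netInflow f (Sum.inr (Sum.inr v)) = 0 :=
      netInflow_vertex_eq_zero_iff.2 (hf.conservation v)
    rw [← Finset.sum_image Sum.inl_injective.injOn]
    refine (Finset.sum_subset (by simpa [Finset.subset_iff] using hin) ?_).symm
    rintro (s | t | v) hx hx'
    · simp at hx'
    · exact absurd hx (hout t)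
    · exact hv v
  rw [hdir.value_eq_neg_sum_netInflow, ← hsum, sum_netInflow, neg_sub]

theorem IsMaxFlow.MC_le_value [Finite T] [Finite V] {k f : E → ℝ} (hf : dir.IsMaxFlow k f)
    (hdir : dir.Compatible) : dir.MC k ≤ dir.value f := by
  classical
  have := Fintype.ofFinite T
  have := Fintype.ofFinite V
  let A : Finset (S ⊕ T ⊕ V) :=
    {x | ∃ s : S, Relation.ReflTransGen (dir.Residual k f) (Sum.inl s) x}
  have hclosed {x y} (hx : x ∈ A) (hxy : dir.Residual k f x y) : y ∈ A := by
    simp only [A, Finset.mem_filter_univ] at hx ⊢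
    exact hx.imp fun s hs => hs.tail hxy
  have hA : G.Separates A :=
    ⟨fun s => by simpa [A] using ⟨s, .refl⟩,
      fun t => by simpa [A] using fun s => hf.not_reflTransGen_residual hdir s t⟩
  have hsaturated (e) (ht : dir.tail e ∈ A) (hh : dir.head e ∉ A) : f e = k e :=
    (hf.1.le_capacity e).eq_of_not_lt fun h => hh (hclosed ht ⟨e, .inl ⟨rfl, rfl, h⟩⟩)
  have hempty (e) (ht : dir.tail e ∉ A) (hh : dir.head e ∈ A) : f e = 0 :=
    ((hf.1.nonneg e).eq_of_not_lt fun h => ht (hclosed hh ⟨e, .inr ⟨rfl, rfl, h⟩⟩)).symm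
  calc dir.MC k ≤ ∑ e with dir.tail e ∈ A ∧ dir.head e ∉ A, k e :=
        (dir.isLeast_MC k).2 ⟨_, ⟨A, hA, by simp⟩, rfl⟩
    _ = ∑ e with dir.tail e ∈ A, f e - ∑ e with dir.head e ∈ A, f e := by
      simp only [Finset.sum_filter, ← Finset.sum_sub_distrib]
      refine Finset.sum_congr rfl fun e _ => ?_
      by_cases ht : dir.tail e ∈ A <;> by_cases hh : dir.head e ∈ A <;>
        simp [ht, hh, hsaturated e, hempty e]
    _ = dir.value f := (hf.1.value_eq_sub hdir hA).symm

end MaxFlowMinCut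

section Routing

variable {α : E → Type*} {c : E → ℕ}

variable (dir α) in
/-- Labels `a e : α e` for all edges `e` arriving at `v`. -/
abbrev InLabels (v : V) : Type _ := (e : {e // dir.head e = Sum.inr (Sum.inr v)}) → α e

variable (dir α) in
/-- Labels `a e : α e` for all edges `e` starting at `v`. -/
abbrev OutLabels (v : V) : Type _ := (e : {e // dir.tail e = Sum.inr (Sum.inr v)}) → α e

/-- The labels of `w` on the edges arriving at `v`. -/
abbrev inLabels (w : ∀ e, α e) (v : V) : dir.InLabels α v := fun e => w e

/-- The labels of `w` on the edges starting at `v`. -/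
abbrev outLabels (w : ∀ e, α e) (v : V) : dir.OutLabels α v := fun e => w e

/-- The labelling `w` of the edges obeys the routing rule `φ` at `v`: the labels leaving `v` are
those prescribed by the labels arriving at `v`. -/
def RoutedAt (φ : ∀ v, dir.InLabels α v ≃ dir.OutLabels α v) (v : V) (w : ∀ e, α e) : Prop :=
  outLabels w v = φ v (inLabels w v)

/-- The labelling `w` of the edges obeys the routing rule `φ` at every internal vertex. -/
def Routed (φ : ∀ v, dir.InLabels α v ≃ dir.OutLabels α v) (w : ∀ e, α e) : Prop :=
  ∀ v, RoutedAt φ v w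

variable (dir α) in
/-- The label of `e` may depend on that of `e'` under a routing rule: `e'` arrives where `e` starts.
Edges with at most one label are left out, since they transmit nothing. -/
def Feeds (e' e : E) : Prop :=
  dir.head e' = dir.tail e ∧ Nontrivial (α e') ∧ Nontrivial (α e)

variable {φ : ∀ v, dir.InLabels α v ≃ dir.OutLabels α v} {ι : ∀ e, α e ↪ Fin (c e)}

theorem RoutedAt.congr {v : V} {w w' : ∀ e, α e} (hw : RoutedAt φ v w)
    (h : ∀ x : G.EndsAt v, w x.1.1 = w' x.1.1) : RoutedAt φ v w' := by
  have hin : (inLabels w v : dir.InLabels α v) = inLabels w' v :=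
    funext fun e => h ⟨(e.1, !dir e.1), e.2⟩
  have hout : (outLabels w v : dir.OutLabels α v) = outLabels w' v :=
    funext fun e => h ⟨(e.1, dir e.1), e.2⟩
  rwa [RoutedAt, hin, hout] at hw

theorem inLabels_eq_of_feeds {e : E} [Nontrivial (α e)] {v : V}
    (he : dir.tail e = Sum.inr (Sum.inr v)) {w w' : ∀ e, α e}
    (h : ∀ e', dir.Feeds α e' e → w e' = w' e') :
    (inLabels w v : dir.InLabels α v) = inLabels w' v := by
  ext e'
  cases subsingleton_or_nontrivial (α e')
  · exact Subsingleton.elim _ _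
  · exact h e' ⟨e'.2.trans he.symm, ‹_›, ‹_›⟩

theorem Routed.eq_of_inputs [Finite E] (hdir : dir.Compatible)
    (hacyc : ∀ e, ¬ Relation.TransGen (dir.Feeds α) e e) {w w' : ∀ e, α e} (hw : Routed φ w)
    (hw' : Routed φ w') (h : ∀ s, w (G.inEdge s) = w' (G.inEdge s)) : w = w' := by
  ext e
  induction e using (wellFounded_of_forall_not_transGen hacyc).induction with | _ e ih
  cases subsingleton_or_nontrivial (α e)
  · exact Subsingleton.elim _ _
  rcases hx : dir.tail e with s | t | v
  · obtain rfl := hdir.tail_eq_inl_iff.1 hx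
    exact h s
  · exact absurd hx (hdir.2 e t)
  · have hin : (inLabels w v : dir.InLabels α v) = inLabels w' v := inLabels_eq_of_feeds hx ih
    exact congrFun ((hw v).trans ((congrArg (φ v) hin).trans (hw' v).symm)) ⟨e, hx⟩

theorem Routed.eq_of_outputs [Finite E] (hdir : dir.Compatible)
    (hacyc : ∀ e, ¬ Relation.TransGen (dir.Feeds α) e e) {w w' : ∀ e, α e} (hw : Routed φ w)
    (hw' : Routed φ w') (h : ∀ t, w (G.outEdge t) = w' (G.outEdge t)) : w = w' := by
  have hwf : WellFounded (Function.swap (dir.Feeds α)) :=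
    wellFounded_of_forall_not_transGen fun e he => hacyc e (Relation.transGen_swap.1 he)
  ext e
  induction e using hwf.induction with | _ e ih
  cases subsingleton_or_nontrivial (α e)
  · exact Subsingleton.elim _ _
  rcases hx : dir.head e with s | t | v
  · exact absurd hx (hdir.1 e s)
  · obtain rfl := eq_outEdge_of_head_eq hx
    exact h t
  · have hout : (outLabels w v : dir.OutLabels α v) = outLabels w' v := by
      ext e'
      cases subsingleton_or_nontrivial (α e')
      · exact Subsingleton.elim _ _
      · exact ih e' ⟨hx.trans e'.2.symm, ‹_›, ‹_›⟩
    exact congrFun ((φ v).injective ((hw v).symm.trans (hout.trans (hw' v)))) ⟨e, hx⟩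

/-- The labelling whose labels leaving the internal vertices are prescribed by `φ` from `w`, and
whose other labels are those of `w₀`. -/
def transport (φ : ∀ v, dir.InLabels α v ≃ dir.OutLabels α v) (w₀ w : ∀ e, α e) (e : E) : α e :=
  match h : dir.tail e with
  | Sum.inr (Sum.inr v) => φ v (inLabels w v) ⟨e, h⟩
  | _ => w₀ e

theorem transport_of_tail_eq_inl {w₀ w : ∀ e, α e} {e : E} {s : S} (h : dir.tail e = Sum.inl s) :
    transport φ w₀ w e = w₀ e := by
  grind [transport]

theorem transport_of_tail_eq_vertex {w₀ w : ∀ e, α e} {e : E} {v : V}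
    (h : dir.tail e = Sum.inr (Sum.inr v)) :
    transport φ w₀ w e = φ v (inLabels w v) ⟨e, h⟩ := by
  grind [transport]

theorem exists_routed [Finite E] [∀ e, Nonempty (α e)] (hdir : dir.Compatible)
    (hacyc : ∀ e, ¬ Relation.TransGen (dir.Feeds α) e e) (x : ∀ s, α (G.inEdge s)) :
    ∃ w, Routed φ w ∧ ∀ s, w (G.inEdge s) = x s := by
  obtain ⟨w₀, hw₀⟩ := exists_extend_of_injective hdir.inEdge_injective x
  have hdep (e : E) : DependsOn (fun w => transport φ w₀ w e) {e' | dir.Feeds α e' e} := by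
    intro w w' h
    cases subsingleton_or_nontrivial (α e)
    · exact Subsingleton.elim _ _
    rcases hx : dir.tail e with s | t | v
    · simp only [transport_of_tail_eq_inl hx]
    · exact absurd hx (hdir.2 e t)
    · simp only [transport_of_tail_eq_vertex hx, inLabels_eq_of_feeds hx h]
  obtain ⟨w, hw⟩ := exists_apply_eq_self_of_dependsOn (wellFounded_of_forall_not_transGen hacyc)
    (transport φ w₀) hdep
  refine ⟨w, fun v => funext fun e => ?_, fun s => ?_⟩
  · rw [← transport_of_tail_eq_vertex (w₀ := w₀) e.2, hw]
  · rw [← hw, transport_of_tail_eq_inl (hdir.tail_inEdge s), hw₀]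

open Classical in
/-- The tensor assignment of a routing rule: labels are embedded as indices by `ι`, and the tensor
at `v` is the indicator of the index tuples that come from labellings routed at `v`. -/
noncomputable def routing (φ : ∀ v, dir.InLabels α v ≃ dir.OutLabels α v)
    (ι : ∀ e, α e ↪ Fin (c e)) : G.TensorAssignment c := fun v x =>
  if ∃ w, RoutedAt φ v w ∧ ∀ h : G.EndsAt v, x h = ι h.1.1 (w h.1.1) then 1 else 0

theorem RoutedAt.routing_apply {v : V} {w : ∀ e, α e} (hw : RoutedAt φ v w) :
    routing φ ι v (fun h => ι h.1.1 (w h.1.1)) = 1 :=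
  if_pos ⟨w, hw, fun _ => rfl⟩

theorem exists_routed_of_routing_ne_zero (hdir : dir.Compatible) {W : ∀ e, Fin (c e)}
    (hS : ∀ s, W (G.inEdge s) ∈ Set.range (ι (G.inEdge s)))
    (hV : ∀ v, routing φ ι v (fun h => W h.1.1) ≠ 0) :
    ∃ w, Routed φ w ∧ ∀ e, ι e (w e) = W e := by
  have hlocal (v : V) : ∃ w, RoutedAt φ v w ∧ ∀ h : G.EndsAt v, W h.1.1 = ι h.1.1 (w h.1.1) :=
    by_contra fun h => hV v (if_neg h)
  have hrange (e : E) : W e ∈ Set.range (ι e) := by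
    rcases hx : dir.tail e with s | t | v
    · exact hdir.tail_eq_inl_iff.1 hx ▸ hS s
    · exact absurd hx (hdir.2 e t)
    · obtain ⟨w, -, hw⟩ := hlocal v
      exact ⟨w e, (hw ⟨(e, dir e), hx⟩).symm⟩
  choose w hw using hrange
  refine ⟨w, fun v => ?_, hw⟩
  obtain ⟨w', hw', hWw'⟩ := hlocal v
  exact hw'.congr fun h => (ι _).injective ((hWw' h).symm.trans (hw _).symm)

variable [Fintype S] [Fintype T] [Fintype V] [Fintype E] [DecidableEq E]

theorem beta_routing_apply (hdir : dir.Compatible)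
    (hacyc : ∀ e, ¬ Relation.TransGen (dir.Feeds α) e e) {w w' : ∀ e, α e} (hw : Routed φ w)
    (hw' : Routed φ w') [Decidable (w' = w)] :
    G.beta c (routing φ ι) (fun t => ι _ (w' (G.outEdge t))) (fun s => ι _ (w (G.inEdge s))) =
      if w' = w then 1 else 0 := by
  have hunique (W : ∀ e, Fin (c e)) (hS : ∀ s, W (G.inEdge s) = ι _ (w (G.inEdge s)))
      (hT : ∀ t, W (G.outEdge t) = ι _ (w' (G.outEdge t)))
      (hW : ∏ v, routing φ ι v (fun h => W h.1.1) ≠ 0) : w' = w ∧ W = fun e => ι e (w e) := by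
    obtain ⟨u, hu, huW⟩ := exists_routed_of_routing_ne_zero hdir (fun s => ⟨_, (hS s).symm⟩)
      fun v => Finset.prod_ne_zero_iff.1 hW v (Finset.mem_univ v)
    obtain rfl : u = w := hu.eq_of_inputs hdir hacyc hw fun s =>
      (ι _).injective ((huW _).trans (hS s))
    obtain rfl : u = w' := hu.eq_of_outputs hdir hacyc hw' fun t =>
      (ι _).injective ((huW _).trans (hT t))
    exact ⟨rfl, funext fun e => (huW e).symm⟩
  split_ifs with hww'
  · subst hww'
    refine (Finset.sum_eq_single (fun e => ι e (w' e)) (fun W _ hne => ?_) (by simp)).trans ?_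
    · refine ite_eq_right_iff.2 fun h => by_contra fun hW => hne (hunique W h.1 h.2 hW).2
    · simp [(hw _).routing_apply]
  · exact Finset.sum_eq_zero fun W _ => ite_eq_right_iff.2 fun h =>
      by_contra fun hW => hww' (hunique W h.1 h.2 hW).1

theorem card_routed_le_rank_beta (hdir : dir.Compatible)
    (hacyc : ∀ e, ¬ Relation.TransGen (dir.Feeds α) e e) [DecidableEq S] :
    Nat.card {w // Routed φ w} ≤ (G.beta c (routing φ ι)).rank := by
  classical
  have (e : E) : Finite (α e) := .of_injective _ (ι e).injective
  have := Fintype.ofFinite {w // Routed φ w}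
  let toOutputs (w : {w // Routed φ w}) (t : T) := ι _ (w.1 (G.outEdge t))
  let toInputs (w : {w // Routed φ w}) (s : S) := ι _ (w.1 (G.inEdge s))
  have hone : (G.beta c (routing φ ι)).submatrix toOutputs toInputs = 1 := by
    ext w' w
    rw [Matrix.submatrix_apply, beta_routing_apply hdir hacyc w.2 w'.2, Matrix.one_apply]
    exact if_congr Subtype.ext_iff.symm rfl rfl
  calc Nat.card {w // Routed φ w} = (1 : Matrix {w // Routed φ w} {w // Routed φ w} ℂ).rank := by
        rw [Matrix.rank_one, Nat.card_eq_fintype_card]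
    _ ≤ (G.beta c (routing φ ι)).rank := by rw [← hone]; exact Matrix.rank_submatrix_le _ _ _

theorem card_inputLabels_le_QMF [∀ e, Nonempty (α e)] (hdir : dir.Compatible)
    (φ : ∀ v, dir.InLabels α v ≃ dir.OutLabels α v) (ι : ∀ e, α e ↪ Fin (c e))
    (hacyc : ∀ e, ¬ Relation.TransGen (dir.Feeds α) e e) [DecidableEq S] :
    Nat.card (∀ s, α (G.inEdge s)) ≤ G.QMF c := by
  have (e : E) : Finite (α e) := .of_injective _ (ι e).injective
  have hsurj : Function.Surjective fun (w : {w // Routed φ w}) s => w.1 (G.inEdge s) := fun x =>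
    let ⟨w, hw, hwx⟩ := exists_routed hdir hacyc x
    ⟨⟨w, hw⟩, funext hwx⟩
  exact (Nat.card_le_card_of_surjective _ hsurj).trans <|
    (card_routed_le_rank_beta (ι := ι) hdir hacyc).trans ((G.isGreatest_QMF c).2 ⟨_, rfl⟩)

theorem prod_inEdge_le_QMF [DecidableEq S] [DecidableEq T] [DecidableEq V] (hdir : dir.Compatible)
    {n : E → ℕ} (hn : ∀ e, 1 ≤ n e) (hnc : ∀ e, n e ≤ c e)
    (hcons : ∀ v : V, ∏ e with dir.head e = Sum.inr (Sum.inr v), n e =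
      ∏ e with dir.tail e = Sum.inr (Sum.inr v), n e)
    (hacyc : ∀ e, ¬ Relation.TransGen (dir.Feeds fun e => Fin (n e)) e e) :
    ∏ s, n (G.inEdge s) ≤ G.QMF c := by
  have (e : E) : Nonempty (Fin (n e)) := ⟨⟨0, hn e⟩⟩
  have hcard (v : V) : Fintype.card (dir.InLabels (fun e => Fin (n e)) v) =
      Fintype.card (dir.OutLabels (fun e => Fin (n e)) v) := by
    simpa only [Fintype.card_pi, Fintype.card_fin, ← Finset.prod_subtype_eq_prod_filter,
      Finset.subtype_univ] using hcons v
  have hle := card_inputLabels_le_QMF hdir (fun v => Fintype.equivOfCardEq (hcard v))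
    (fun e => Fin.castLEEmb (hnc e)) hacyc
  simpa only [Nat.card_eq_fintype_card, Fintype.card_pi, Fintype.card_fin] using hle

end Routing

theorem not_transGen_feeds_of_not_hasFlowLoop {α : E → Type*} {f : E → ℝ}
    (hloop : ¬ dir.HasFlowLoop f) (hα : ∀ e, Nontrivial (α e) → f e ≠ 0) (e : E) :
    ¬ Relation.TransGen (dir.Feeds α) e e := fun he =>
  hloop ⟨dir.tail e, he.lift dir.tail fun e' _ h => ⟨e', rfl, h.1, hα e' h.2.1⟩⟩

theorem IsFlow.prod_head_eq_prod_tail [Fintype E] [DecidableEq S] [DecidableEq T] [DecidableEq V]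
    {d : ℝ} (hd0 : 0 < d) (hd1 : d ≠ 1) {k f : E → ℝ} (hf : dir.IsFlow k f) {n : E → ℕ}
    (hn : ∀ e, 1 ≤ n e) (hfn : ∀ e, f e = Real.logb d (n e)) (v : V) :
    ∏ e with dir.head e = Sum.inr (Sum.inr v), n e =
      ∏ e with dir.tail e = Sum.inr (Sum.inr v), n e := by
  have hpos (s : Finset E) : ((∏ e ∈ s, n e : ℕ) : ℝ) ∈ Set.Ioi 0 :=
    Set.mem_Ioi.2 (Nat.cast_pos.2 (Finset.prod_pos fun e _ => hn e))
  refine Nat.cast_injective (logb_injOn_pos_of_ne_one hd0 hd1 (hpos _) (hpos _) ?_)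
  simpa only [logb_natCast_prod _ hn, ← hfn] using hf.conservation v

end Direction

end OpenGraph

theorem proposition3p8 {S T V E : Type*}
    [Fintype S] [Fintype T] [Fintype V] [Fintype E]
    [DecidableEq S] [DecidableEq T] [DecidableEq V] [DecidableEq E]
    (G : OpenGraph S T V E) (c : E → ℕ) (hc : ∀ e, 1 ≤ c e)
    (d : ℝ) (hd0 : 0 < d) (hd1 : d ≠ 1) (hlog : ∀ e, 0 ≤ Real.logb d (c e))
    (dir : G.Direction) (hdir : dir.Compatible)
    (hcut : dir.MC (fun e => Real.logb d (c e)) = Real.logb d (G.QMC c))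
    (f : E → ℝ) (hf : dir.IsMaxFlow (fun e => Real.logb d (c e)) f)
    (hint : ∀ e, ∃ n : ℕ, 1 ≤ n ∧ f e = Real.logb d n)
    (hloop : ¬ dir.HasFlowLoop f) :
    G.QMF c = G.QMC c := by
  refine le_antisymm (G.QMF_le_QMC c) ?_
  choose n hn hfn using hint
  have hn' (e : E) : (1 : ℝ) ≤ n e := Nat.one_le_cast.2 (hn e)
  have hnc (e : E) : n e ≤ c e := by
    refine Nat.cast_le.1 (le_of_logb_le_logb hd0 hd1 (one_pos.trans_le (hn' e))
      (Nat.one_le_cast.2 (hc e)) ?_ ?_) <;> rw [← hfn]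
    exacts [hf.1.nonneg e, hf.1.le_capacity e]
  have hacyc := OpenGraph.Direction.not_transGen_feeds_of_not_hasFlowLoop
    (α := fun e => Fin (n e)) hloop fun e he => by
      rw [hfn, ← Real.logb_one (b := d)]
      exact (logb_injOn_pos_of_ne_one hd0 hd1).ne (one_pos.trans_le (hn' e))
        (Set.mem_Ioi.2 one_pos) (Nat.cast_ne_one.2 (Nat.ne_of_gt (Fin.nontrivial_iff_two_le.1 he)))
  have hvalue : dir.value f = Real.logb d (∏ s, n (G.inEdge s) : ℕ) := by
    simp only [hdir.value_eq_sum_inEdge, hfn, logb_natCast_prod _ fun s => hn (G.inEdge s)]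
  calc G.QMC c ≤ ∏ s, n (G.inEdge s) :=
      Nat.cast_le.1 <| le_of_logb_le_logb hd0 hd1 (Nat.cast_pos.2 (OpenGraph.QMC_pos hc))
        (Nat.one_le_cast.2 (Finset.one_le_prod' fun s _ => hn _))
        (OpenGraph.logb_QMC_nonneg hc hlog) <| hcut ▸ hvalue ▸ hf.MC_le_value hdir
    _ ≤ G.QMF c := OpenGraph.Direction.prod_inEdge_le_QMF hdir hn hnc
        (hf.1.prod_head_eq_prod_tail hd0 hd1 hn hfn) hacyc
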